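/- **Setting.** Let $d,s,g,B,\rho$ be natural numbers with $1\le g<s$, $g\mid d$, $(s-g)\mid B$, $\rho$ even, and (R1) $\frac dg\ge\frac{\rho B}{s-g}+1$, (R2) $\frac{\rho B}{2(s-g)}\ge\frac sg-1$, (R3) $B\ge s-g$; call such parameters admissible. For a graph $G$ on $[d]$ with edge weights in $\mathbb N$, the weight-degree $\rho(G)$ is the largest number of neighbours of a vertex that are joined to it by edges of one and the same weight. The $(G,s,g,B)$-weighted graph model (WGM) $\mathbb M$ is the set of all $S\subseteq[d]$ with $|S|=s$ that are the vertex set of a forest $F\subseteq G$ with $g$ connected components and total edge weight at most $B$. *Graph construction.* Divide the $d$ nodes into $g$ groups of $d/g$ nodes $N^j_i$ (group $j$, index $i$ taken modulo $d/g$). For each $p=1,\dots,\frac{B}{s-g}$, join $N^j_i$ to $N^j_{i+(p-1)\rho/2+1},\dots,N^j_{i+p\rho/2}$ by edges of weight $p$; there are no other edges inside a group. Edges between different groups are optional, but have weights greater than $\frac{B}{s-g}$ and leave $\rho(G)=\rho$. *Ensemble.* For $C_0,\sigma>0$ and $0<\epsilon<1$ let $\mathcal F$ be the set of $\beta\in\mathbb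 R^d$ for which there is $S\in\mathbb M$ with $\beta_i=0$ for $i\notin S$ and $\beta_i\in\left\{\frac{C_0\sigma\sqrt d}{\sqrt{2(1-\epsilon)}},\ \frac{C_0\sigma\sqrt d}{\sqrt{2(1-\epsilon)}}+\frac{C_0\sigma\sqrt d}{\sqrt{1-\epsilon}}\right\}$ for $i\in S$. *Observations.* Let $\bar\beta$ be uniform on $\mathcal F$, let $X\in\mathbb R^{n\times d}$ have i.i.d. $N(0,1)$ entries, and let $e\in\mathbb R^n$ have i.i.d. centred Gaussian entries with standard deviation $\sigma$; $\bar\beta,X,e$ are independent. The data are $z=f(X\bar\beta+e)$ for a fixed measurable $f:\mathbb R^n\to\mathbb R^n$. An estimator $\hat\beta$ is any, possibly randomized, $\mathbb R^d$-valued function of the observed output $z$ (that is, a Markov kernel from $\mathbb R^n$ to $\mathbb R^d$, so that $\bar\beta\to X\bar\beta+e\to z\to\hat\beta$ is a Markov chain). **Theorem.** Let $(d_k,s_k,g_k,B_k,\rho_k)_k$ be any sequence of admissible parameters. Then for every $k$ a graph as in the construction exists. Moreover, if the sample sizes $n=n_k$ satisfy, as $k\to\infty$, $$n\in o\Big((s-g)\big(\log\rho+\log\tfrac{B}{s-g}\big)+g\log\tfrac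 dg+(s-g)\log\tfrac{g}{s-g}+s\log 2\Big),$$ then for all sufficiently large $k$, for every graph $G$ as in the construction (so $\rho(G)=\rho$), all $C_0,\sigma>0$, all $0<\epsilon<1$, every measurable $f$, every estimator $\hat\beta$ and every $0<C\le C_0$, $$\mathbb P\big(\|\bar\beta-\hat\beta\|\ge C\|e\|\big)\ge\tfrac1{10},$$ where $\|\cdot\|$ is the Euclidean norm. -/

import Mathlib

open Filter MeasureTheory ProbabilityTheory Asymptotics

noncomputable section

namespace GraphSparsity

/-- A graph on the vertex set `[d]` with natural-number edge weights. The values of `weight` outside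
the edge set are never used. -/
structure WeightedGraph (d : ℕ) where
  graph : SimpleGraph (Fin d)
  weight : Sym2 (Fin d) → ℕ

/-- The weight-degree of `G`: the maximum, over all vertices `v` and all weights `b`, of the number
of neighbours of `v` that are joined to `v` by an edge of weight `b`. -/
def WeightedGraph.weightDegree {d : ℕ} (G : WeightedGraph d) : ℕ :=
  ⨆ v : Fin d, ⨆ b : ℕ, {v' : Fin d | G.graph.Adj v' v ∧ G.weight s(v', v) = b}.ncard

/-- The `(G, s, g, B)`-weighted graph model: the supports `S ⊆ [d]` with `s` elements that are the
vertex set of a forest `F ⊆ G` with `g` connected components and total edge weight at most `B`. -/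
def WeightedGraph.model {d : ℕ} (G : WeightedGraph d) (s g B : ℕ) : Set (Finset (Fin d)) :=
  {S | S.card = s ∧ ∃ F : G.graph.Subgraph,
    F.verts = (S : Set (Fin d)) ∧ F.coe.IsAcyclic ∧
    Nat.card F.coe.ConnectedComponent = g ∧ ∑ᶠ e ∈ F.edgeSet, G.weight e ≤ B}

/-- The requirements on the parameters: `d` is the dimension, `s` the sparsity, `g` the number of
components, `B` the weight budget and `ρ` the weight-degree. The divisibility conditions say that
the number `d / g` of nodes per group, the number `B / (s - g)` of weight levels and `ρ / 2` are
integers. -/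
structure Admissible (d s g B ρ : ℕ) : Prop where
  g_pos : 0 < g
  g_lt_s : g < s
  g_dvd_d : g ∣ d
  dvd_B : (s - g) ∣ B
  even_ρ : Even ρ
  req1 : (ρ : ℝ) * B / ((s : ℝ) - g) + 1 ≤ (d : ℝ) / g
  req2 : (s : ℝ) / g - 1 ≤ (ρ : ℝ) * B / (2 * ((s : ℝ) - g))
  req3 : (s : ℝ) - g ≤ B

/-- `G` is built by the following recipe. The `d` nodes are divided into `g` groups of `d / g` nodes
each; `node (j, i)` is the `i`-th node of group `j`, with circular indexing in `i`.
For every `p = 1, …, B / (s - g)` the node `(j, i)` is joined to the nodes `(j, i + t)`,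
`(p - 1) * (ρ / 2) + 1 ≤ t ≤ p * (ρ / 2)`, by edges of weight `p`, and there are no other edges inside
a group. Edges between different groups are optional, but must have weights greater than
`B / (s - g)` and must not affect the weight-degree, which is `ρ`. -/
structure IsConstruction {d : ℕ} (s g B ρ : ℕ) (node : Fin g × ZMod (d / g) ≃ Fin d)
    (G : WeightedGraph d) : Prop where
  adj_iff : ∀ (j : Fin g) (i i' : ZMod (d / g)),
    G.graph.Adj (node (j, i)) (node (j, i')) ↔
      ∃ p ∈ Finset.Icc 1 (B / (s - g)),
        ∃ t ∈ Finset.Icc ((p - 1) * (ρ / 2) + 1) (p * (ρ / 2)),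
          i' = i + (t : ZMod (d / g)) ∨ i = i' + (t : ZMod (d / g))
  weight_eq : ∀ (j : Fin g) (i : ZMod (d / g)), ∀ p ∈ Finset.Icc 1 (B / (s - g)),
    ∀ t ∈ Finset.Icc ((p - 1) * (ρ / 2) + 1) (p * (ρ / 2)),
      G.weight s(node (j, i), node (j, i + (t : ZMod (d / g)))) = p
  cross_weight : ∀ (j j' : Fin g) (i i' : ZMod (d / g)), j ≠ j' →
    G.graph.Adj (node (j, i)) (node (j', i')) →
      B / (s - g) < G.weight s(node (j, i), node (j', i'))
  weightDegree_eq : G.weightDegree = ρ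

/-- The sample-size expression
`(s-g)(log ρ + log (B/(s-g))) + g log (d/g) + (s-g) log (g/(s-g)) + s log 2`. -/
def sampleBound (d s g B ρ : ℕ) : ℝ :=
  ((s : ℝ) - g) * (Real.log ρ + Real.log ((B : ℝ) / ((s : ℝ) - g)))
    + g * Real.log ((d : ℝ) / g)
    + ((s : ℝ) - g) * Real.log ((g : ℝ) / ((s : ℝ) - g))
    + s * Real.log 2

/-- The restricted ensemble: vectors supported on some `S` of the `(G, s, g, B)`-weighted graph model
whose entries on `S` take one of two values of order `C₀ σ √d`. -/
def ensemble {d : ℕ} (G : WeightedGraph d) (s g B : ℕ) (C₀ σ ε : ℝ) :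
    Set (EuclideanSpace ℝ (Fin d)) :=
  {β | ∃ S ∈ G.model s g B, (∀ i ∉ S, β i = 0) ∧ ∀ i ∈ S,
    β i = C₀ * σ * √d / √(2 * (1 - ε)) ∨
    β i = C₀ * σ * √d / √(2 * (1 - ε)) + C₀ * σ * √d / √(1 - ε)}

/-- An outcome `(β, X, e)`: true vector, design matrix, noise. -/
abbrev Outcome (d n : ℕ) : Type :=
  EuclideanSpace ℝ (Fin d) × (Fin n → Fin d → ℝ) × (Fin n → ℝ)

/-- The joint law of `(β, X, e)`: independent, `β` uniform on the finite set `A`, the entries of `X`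
i.i.d. `N(0, 1)` and the entries of `e` i.i.d. centred Gaussian with standard deviation `σ`. -/
def sourceLaw {d : ℕ} (n : ℕ) (A : Set (EuclideanSpace ℝ (Fin d))) (σ : ℝ) :
    Measure (Outcome d n) :=
  (uniformOn A).prod
    ((Measure.pi fun _ : Fin n => Measure.pi fun _ : Fin d => gaussianReal 0 1).prod
      (Measure.pi fun _ : Fin n => gaussianReal 0 (σ ^ 2).toNNReal))

/-- The linear predictor with noise, `y = X β + e`. -/
def linearResponse {d n : ℕ} (ω : Outcome d n) : Fin n → ℝ :=
  (Matrix.of ω.2.1).mulVec (WithLp.ofLp ω.1) + ω.2.2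

lemma measurable_linearResponse {d n : ℕ} :
    Measurable (linearResponse : Outcome d n → Fin n → ℝ) := by
  unfold linearResponse Matrix.mulVec dotProduct
  refine measurable_pi_lambda _ fun i => ?_
  simp only [Pi.add_apply, Matrix.of_apply]
  fun_prop

/-- The joint law of `((β, X, e), β̂)`, where the (possibly randomized) estimate `β̂` is drawn from the
observation `z = f (X β + e)` through the Markov kernel `κ`. -/
def jointLaw {d : ℕ} (n : ℕ) (A : Set (EuclideanSpace ℝ (Fin d))) (σ : ℝ)
    (f : (Fin n → ℝ) → (Fin n → ℝ)) (hf : Measurable f)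
    (κ : Kernel (Fin n → ℝ) (EuclideanSpace ℝ (Fin d))) :
    Measure (Outcome d n × EuclideanSpace ℝ (Fin d)) :=
  (sourceLaw n A σ).compProd
    (κ.comap (fun ω => f (linearResponse ω)) (hf.comp measurable_linearResponse))

/-- The event `‖β - β̂‖ ≥ C ‖e‖` (Euclidean norms). -/
def errorEvent (d n : ℕ) (C : ℝ) : Set (Outcome d n × EuclideanSpace ℝ (Fin d)) :=
  {x | C * ‖(WithLp.toLp 2 x.1.2.2 : EuclideanSpace ℝ (Fin n))‖ ≤ ‖x.1.1 - x.2‖}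

end GraphSparsity

end

/-! The design is Gaussian, so the law of the response depends on the parameter only through its
norm (`map_linearResponse`), and so does the law of anything computed from the response. The
ensemble has very few norms: on a support of size `s` the norm is determined by how many entries
take the upper value, which leaves at most `s + 1` norms against `|M| * 2 ^ s` vectors, `M` being
the set of supports in the model. Distinct vectors are at least `δ = C₀ σ √d / √(1 - ε)` apart, so
among vectors of equal norm the balls of radius `δ / 2` are disjoint and an estimate hits the right
one for at most one vector per norm on average (`jointLaw_close_le`). The supports cover all `d`
nodes, hence `|M| ≥ d / s`, and the estimate is within `δ / 2` with probability at most `s (s + 1) /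
(d 2 ^ s) ≤ 3 / (2 d)`.

The sample size matters only for the noise. The sample bound is at most `2 d` (`sampleBound_le`), so
eventually `n ≤ d / 10`, and Markov's inequality gives `‖e‖ < σ √d / 2` with probability at least `6
/ 10`. When both good events hold, the error is at least `δ / 2 ≥ C ‖e‖`. No entropy argument is
needed. -/

noncomputable section

namespace GraphSparsity

/-! ### Arithmetic of admissible parameters. -/

namespace Admissible

variable {d s g B ρ : ℕ}

lemma level_mul (h : Admissible d s g B ρ) : B / (s - g) * (s - g) = B :=
  Nat.div_mul_cancel h.dvd_B

lemma cast_sub_pos (h : Admissible d s g B ρ) : (0 : ℝ) < (s : ℝ) - g :=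
  sub_pos.2 (by exact_mod_cast h.g_lt_s)

lemma cast_level (h : Admissible d s g B ρ) :
    (B : ℝ) / ((s : ℝ) - g) = ((B / (s - g) : ℕ) : ℝ) := by
  have hs := h.g_lt_s.le
  rw [Nat.cast_div h.dvd_B (by rw [Nat.cast_sub hs]; exact h.cast_sub_pos.ne'), Nat.cast_sub hs]

lemma one_le_level (h : Admissible d s g B ρ) : 1 ≤ B / (s - g) := by
  rw [Nat.one_le_div_iff (Nat.sub_pos_of_lt h.g_lt_s)]
  have := h.req3
  rw [← Nat.cast_sub h.g_lt_s.le] at this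
  exact_mod_cast this

lemma two_le_ρ (h : Admissible d s g B ρ) : 2 ≤ ρ := by
  have h2 := h.req2
  have : ρ ≠ 0 := by
    rintro rfl
    have hg : (0 : ℝ) < g := by exact_mod_cast h.g_pos
    have : (1 : ℝ) < s / g := by
      rw [one_lt_div hg]; exact_mod_cast h.g_lt_s
    simp at h2
    linarith
  obtain ⟨r, hr⟩ := h.even_ρ
  omega

lemma one_le_half_ρ (h : Admissible d s g B ρ) : 1 ≤ ρ / 2 := by
  have := h.two_le_ρ; omega

lemma half_ρ_mul_two (h : Admissible d s g B ρ) : ρ / 2 * 2 = ρ :=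
  Nat.div_mul_cancel h.even_ρ.two_dvd

lemma group_mul (h : Admissible d s g B ρ) : d / g * g = d := Nat.div_mul_cancel h.g_dvd_d

lemma cast_group (h : Admissible d s g B ρ) : (d : ℝ) / g = ((d / g : ℕ) : ℝ) := by
  rw [Nat.cast_div h.g_dvd_d (by exact_mod_cast h.g_pos.ne')]

lemma ρ_mul_level_lt (h : Admissible d s g B ρ) : ρ * (B / (s - g)) < d / g := by
  have := h.req1
  rw [mul_div_assoc, h.cast_level, h.cast_group] at this
  exact_mod_cast this

/-- All offsets used in a group stay below half the cycle length, so distinct signed offsets remain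
distinct modulo `d / g`. -/
lemma two_mul_half_ρ_mul_level_lt (h : Admissible d s g B ρ) :
    2 * (B / (s - g) * (ρ / 2)) < d / g := by
  have h1 := h.ρ_mul_level_lt
  rw [← h.half_ρ_mul_two] at h1
  nlinarith

/-- The second requirement without division. -/
lemma two_mul_le (h : Admissible d s g B ρ) : 2 * (s - g) ≤ ρ * (B / (s - g)) * g := by
  have h2 := h.req2
  have hg : (0 : ℝ) < g := by exact_mod_cast h.g_pos
  have e : (ρ : ℝ) * B / (2 * ((s : ℝ) - g)) = ρ * ((B / (s - g) : ℕ) : ℝ) / 2 := by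
    rw [← h.cast_level]
    have := h.cast_sub_pos.ne'
    field_simp
  rw [e, sub_le_iff_le_add, div_le_iff₀ hg] at h2
  have : (2 : ℝ) * ((s - g : ℕ) : ℝ) ≤ ρ * ((B / (s - g) : ℕ) : ℝ) * g := by
    rw [Nat.cast_sub h.g_lt_s.le]; nlinarith
  exact_mod_cast this

lemma two_mul_s_le (h : Admissible d s g B ρ) : 2 * s ≤ d + g := by
  have h1 := h.two_mul_le
  have h2 := Nat.mul_le_mul_right g (Nat.succ_le_of_lt h.ρ_mul_level_lt)
  rw [h.group_mul, Nat.succ_mul] at h2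
  have := h.g_lt_s
  omega

lemma s_le_d (h : Admissible d s g B ρ) : s ≤ d := by
  have := h.two_mul_s_le; have := h.g_lt_s; omega

lemma d_pos (h : Admissible d s g B ρ) : 0 < d := by
  have := h.s_le_d; have := h.g_lt_s; omega

lemma group_pos (h : Admissible d s g B ρ) : 0 < d / g := (Nat.zero_le _).trans_lt h.ρ_mul_level_lt

/-- The only possibly negative term, `log (g / (s - g))`, is absorbed by `log ρ + log (B / (s -
g))`: the second requirement makes the product of the three arguments at least `2`. -/
lemma sampleBound_nonneg (h : Admissible d s g B ρ) : 0 ≤ sampleBound d s g B ρ := by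
  have hg : (0 : ℝ) < g := by exact_mod_cast h.g_pos
  have hsg := h.cast_sub_pos
  have hρ : (0 : ℝ) < ρ := by exact_mod_cast (by have := h.two_le_ρ; omega : 0 < ρ)
  have hL : (0 : ℝ) < ((B / (s - g) : ℕ) : ℝ) := by exact_mod_cast h.one_le_level
  have h1 : 0 ≤ Real.log ((d : ℝ) / g) := by
    rw [h.cast_group]; exact Real.log_natCast_nonneg _
  have h2 : 0 ≤ Real.log 2 := Real.log_nonneg one_le_two
  have h3 : 0 ≤ (Real.log ρ + Real.log ((B : ℝ) / ((s : ℝ) - g)))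
      + Real.log ((g : ℝ) / ((s : ℝ) - g)) := by
    rw [h.cast_level, ← Real.log_mul hρ.ne' hL.ne', ← Real.log_mul (by positivity) (by positivity)]
    apply Real.log_nonneg
    rw [mul_div_assoc', one_le_div hsg]
    have := h.two_mul_le
    have : (2 : ℝ) * ((s - g : ℕ) : ℝ) ≤ ρ * ((B / (s - g) : ℕ) : ℝ) * g := by exact_mod_cast this
    rw [Nat.cast_sub h.g_lt_s.le] at this
    linarith
  have e : sampleBound d s g B ρ = ((s : ℝ) - g) * ((Real.log ρ + Real.log ((B : ℝ) / ((s : ℝ) - g)))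
      + Real.log ((g : ℝ) / ((s : ℝ) - g))) + g * Real.log ((d : ℝ) / g) + s * Real.log 2 := by
    unfold sampleBound; ring
  rw [e]
  positivity

/-- Since `ρ * (B / (s - g)) < d / g`, the terms with factor `s - g` combine to at most `(s - g) log
(d / (s - g))`. Then `log x ≤ x - 1` bounds the summands by `d - (s - g)`, `d - g` and `s`, which
add up to `2 d`. -/
lemma sampleBound_le (h : Admissible d s g B ρ) : sampleBound d s g B ρ ≤ 2 * d := by
  have hg : (0 : ℝ) < g := by exact_mod_cast h.g_pos
  have hd : (0 : ℝ) < d := by exact_mod_cast h.d_pos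
  have hsg := h.cast_sub_pos
  have hρ : (0 : ℝ) < ρ := by exact_mod_cast (by have := h.two_le_ρ; omega : 0 < ρ)
  have hL : (0 : ℝ) < ((B / (s - g) : ℕ) : ℝ) := by exact_mod_cast h.one_le_level
  have h1 : Real.log ρ + Real.log ((B : ℝ) / ((s : ℝ) - g)) ≤ Real.log ((d : ℝ) / g) := by
    rw [h.cast_level, ← Real.log_mul hρ.ne' hL.ne', h.cast_group]
    exact Real.log_le_log (by positivity) (by exact_mod_cast h.ρ_mul_level_lt.le)
  have h2 : Real.log ((d : ℝ) / g) + Real.log ((g : ℝ) / ((s : ℝ) - g)) ≤ d / ((s : ℝ) - g) - 1 := by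
    rw [← Real.log_mul (by positivity) (by positivity), div_mul_div_cancel₀ hg.ne']
    exact Real.log_le_sub_one_of_pos (by positivity)
  have h3 : Real.log ((d : ℝ) / g) ≤ d / g - 1 := Real.log_le_sub_one_of_pos (by positivity)
  have h4 : Real.log 2 ≤ 1 := by have := Real.log_two_lt_d9; linarith
  have h5 : ((s : ℝ) - g) * ((Real.log ρ + Real.log ((B : ℝ) / ((s : ℝ) - g)))
      + Real.log ((g : ℝ) / ((s : ℝ) - g))) ≤ ((s : ℝ) - g) * (d / ((s : ℝ) - g) - 1) :=
    mul_le_mul_of_nonneg_left (by linarith) hsg.le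
  have h6 : (g : ℝ) * Real.log ((d : ℝ) / g) ≤ g * (d / g - 1) :=
    mul_le_mul_of_nonneg_left h3 hg.le
  have h7 : (s : ℝ) * Real.log 2 ≤ s * 1 := mul_le_mul_of_nonneg_left h4 (Nat.cast_nonneg _)
  have e1 : ((s : ℝ) - g) * (d / ((s : ℝ) - g) - 1) = d - (s - g) := by
    field_simp
  have e2 : (g : ℝ) * (d / g - 1) = d - g := by field_simp
  unfold sampleBound
  linarith

end Admissible

/-! ### Existence of the construction: circulant graphs. -/

/-- The circulant graph on each of the groups, without edges between different groups; `L` is the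
number of weight levels and `r` the number of edges of a given weight in either direction. -/
def circulant {d g D : ℕ} (L r : ℕ) (node : Fin g × ZMod D ≃ Fin d) : WeightedGraph d where
  graph :=
    { Adj := fun u v => (node.symm u).1 = (node.symm v).1 ∧
        1 ≤ ((node.symm u).2 - (node.symm v).2).valMinAbs.natAbs ∧
        ((node.symm u).2 - (node.symm v).2).valMinAbs.natAbs ≤ L * r
      symm := ⟨fun u v h => by
        rw [← neg_sub, ZMod.natAbs_valMinAbs_neg]
        exact ⟨h.1.symm, h.2⟩⟩
      loopless := ⟨fun u h => by simp at h⟩ }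
  weight := Sym2.lift ⟨fun u v =>
      (((node.symm u).2 - (node.symm v).2).valMinAbs.natAbs + r - 1) / r, fun u v => by
    beta_reduce
    rw [← neg_sub, ZMod.natAbs_valMinAbs_neg]⟩

/-- The quotient is the ceiling of `t / r`, so the weight in `circulant` sorts the offsets into
consecutive blocks of length `r`, starting with level `1`. -/
lemma level_eq_iff {r t b : ℕ} (hr : 1 ≤ r) (ht : 1 ≤ t) :
    (t + r - 1) / r = b ↔ 1 ≤ b ∧ (b - 1) * r < t ∧ t ≤ b * r := by
  rw [Nat.div_eq_iff (by omega)]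
  rcases b with _ | b
  · simp; omega
  · rw [Nat.add_sub_cancel, Nat.add_mul, one_mul]
    omega

/-- The neighbours at level `a + 1` correspond to the `2 * r` integers of absolute value in `(a r, a
r + r]`; by `hD` each of them is its own minimal residue modulo `D`. -/
lemma circulant_ncard {d g D L r : ℕ} [NeZero D] (hr : 1 ≤ r) (hD : 2 * (L * r) < D)
    (node : Fin g × ZMod D ≃ Fin d) (v : Fin d) {b : ℕ} (hb : 1 ≤ b) (hbL : b ≤ L) :
    {v' : Fin d | (circulant L r node).graph.Adj v' v ∧
      (circulant L r node).weight s(v', v) = b}.ncard = 2 * r := by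
  obtain ⟨a, rfl⟩ := Nat.exists_eq_add_of_le' hb
  set T : Finset ℤ := Finset.Ioc ((a * r : ℕ) : ℤ) ((a * r + r : ℕ) : ℤ) ∪
    Finset.Ico (-((a * r + r : ℕ) : ℤ)) (-((a * r : ℕ) : ℤ)) with hT
  have hle : a * r + r ≤ L * r := by
    have := Nat.mul_le_mul_right r hbL
    rwa [Nat.add_mul, one_mul] at this
  have hmem : ∀ x : ℤ, x ∈ T ↔ a * r < x.natAbs ∧ x.natAbs ≤ a * r + r := by
    intro x
    simp only [hT, Finset.mem_union, Finset.mem_Ioc, Finset.mem_Ico]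
    generalize a * r = q
    omega
  have hcard : T.card = 2 * r := by
    rw [hT, Finset.card_union_of_disjoint, Int.card_Ioc, Int.card_Ico]
    · generalize a * r = q
      omega
    · rw [Finset.disjoint_left]
      intro x
      simp only [Finset.mem_Ioc, Finset.mem_Ico]
      generalize a * r = q
      omega
  rw [← hcard, ← Set.ncard_coe_finset]
  symm
  have hval : ∀ x ∈ T, ((x : ZMod D)).valMinAbs = x := by
    intro x hx
    rw [ZMod.valMinAbs_spec]
    rw [hmem] at hx
    refine ⟨rfl, ?_⟩
    rw [Set.mem_Ioc]
    omega
  refine Set.ncard_congr (fun x _ => node ((node.symm v).1, (node.symm v).2 + (x : ZMod D))) ?_ ?_ ?_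
  · intro x hx
    have hv := hval x hx
    have hx' := (hmem x).1 hx
    have h1 : 1 ≤ x.natAbs := by omega
    simp only [circulant, Set.mem_ofPred_eq, Equiv.symm_apply_apply, add_sub_cancel_left, hv,
      Sym2.lift_mk, level_eq_iff hr h1, true_and]
    refine ⟨⟨h1, by omega⟩, by omega, by simpa using hx'.1, ?_⟩
    rw [Nat.add_mul, one_mul]
    exact hx'.2
  · intro x y hx hy h
    have h := congrArg Prod.snd (node.injective h)
    have := add_left_cancel h
    rw [← hval x hx, this, hval y hy]
  · rintro w ⟨⟨h1, h2, h3⟩, h4⟩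
    refine ⟨((node.symm w).2 - (node.symm v).2).valMinAbs, ?_, ?_⟩
    · rw [Finset.mem_coe, hmem]
      simp only [circulant, Sym2.lift_mk, level_eq_iff hr h2] at h4
      rw [Nat.add_sub_cancel, Nat.add_mul, one_mul] at h4
      exact h4.2
    · rw [ZMod.coe_valMinAbs, ← h1]
      simp

lemma circulant_weightDegree {d g D L r : ℕ} [NeZero D] [Nonempty (Fin d)] (hr : 1 ≤ r)
    (hL : 1 ≤ L) (hD : 2 * (L * r) < D) (node : Fin g × ZMod D ≃ Fin d) :
    (circulant L r node).weightDegree = 2 * r := by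
  unfold WeightedGraph.weightDegree
  have hle : ∀ (v : Fin d) (b : ℕ), {v' : Fin d | (circulant L r node).graph.Adj v' v ∧
      (circulant L r node).weight s(v', v) = b}.ncard ≤ 2 * r := by
    intro v b
    by_cases hb : 1 ≤ b ∧ b ≤ L
    · exact (circulant_ncard hr hD node v hb.1 hb.2).le
    · convert Nat.zero_le _
      rw [Set.ncard_eq_zero, Set.eq_empty_iff_forall_notMem]
      rintro w ⟨⟨h1, h2, h3⟩, h4⟩
      simp only [circulant, Sym2.lift_mk, level_eq_iff hr h2] at h4
      refine hb ⟨h4.1, ?_⟩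
      by_contra hlt
      have := Nat.mul_le_mul_right r (show L ≤ b - 1 by omega)
      omega
  have : ∀ v : Fin d, (⨆ b : ℕ, {v' : Fin d | (circulant L r node).graph.Adj v' v ∧
      (circulant L r node).weight s(v', v) = b}.ncard) = 2 * r := fun v =>
    le_antisymm (ciSup_le' (hle v))
      -- The weights range over all of `ℕ`, so boundedness must be supplied; weight `1` attains the
      -- supremum.
      (le_ciSup_of_le ⟨2 * r, by rintro _ ⟨b, rfl⟩; exact hle v b⟩ 1
        (circulant_ncard hr hD node v le_rfl hL).ge)
  simp_rw [this, ciSup_const]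

lemma natAbs_valMinAbs_natCast {D t : ℕ} (h : 2 * t < D) :
    ((t : ZMod D)).valMinAbs.natAbs = t := by
  rw [ZMod.valMinAbs_natCast_of_le_half (by omega), Int.natAbs_natCast]

/-- All optional edges between groups are omitted, which makes the condition on cross weights
vacuous. -/
theorem Admissible.exists_isConstruction {d s g B ρ : ℕ} (h : Admissible d s g B ρ) :
    ∃ (node : Fin g × ZMod (d / g) ≃ Fin d) (G : WeightedGraph d),
      IsConstruction s g B ρ node G := by
  have hD := h.two_mul_half_ρ_mul_level_lt
  have hr := h.one_le_half_ρ
  have : NeZero (d / g) := ⟨h.group_pos.ne'⟩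
  have : Nonempty (Fin d) := ⟨⟨0, h.d_pos⟩⟩
  have hcard : Fintype.card (Fin g × ZMod (d / g)) = Fintype.card (Fin d) := by
    rw [Fintype.card_prod, ZMod.card, Fintype.card_fin, Fintype.card_fin, mul_comm, h.group_mul]
  have node := Fintype.equivOfCardEq hcard
  set L := B / (s - g)
  set r := ρ / 2
  have hpr : ∀ p ∈ Finset.Icc 1 L, ∀ t ∈ Finset.Icc ((p - 1) * r + 1) (p * r),
      1 ≤ t ∧ t ≤ L * r := by
    intro p hp t ht
    rw [Finset.mem_Icc] at hp ht
    have := Nat.mul_le_mul_right r hp.2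
    omega
  refine ⟨node, circulant L r node, ?_, ?_, ?_, ?_⟩
  · intro j i i'
    simp only [circulant, Equiv.symm_apply_apply, true_and]
    constructor
    · rintro ⟨h1, h2⟩
      set t := (i - i').valMinAbs.natAbs with ht
      obtain ⟨hb, hb1, hb2⟩ := (level_eq_iff hr h1).1 rfl
      refine ⟨(t + r - 1) / r, Finset.mem_Icc.2 ⟨hb, ?_⟩, t, Finset.mem_Icc.2 ⟨hb1, hb2⟩, ?_⟩
      · by_contra hlt
        have := Nat.mul_le_mul_right r (show L ≤ (t + r - 1) / r - 1 by omega)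
        omega
      -- The sign of the minimal residue decides from which of the two nodes the offset is counted.
      · rw [ht, ZMod.natCast_natAbs_valMinAbs]
        split_ifs
        · right; ring
        · left; ring
    · rintro ⟨p, hp, t, ht, rfl | rfl⟩
      · have := hpr p hp t ht
        rwa [sub_add_cancel_left, ZMod.natAbs_valMinAbs_neg, natAbs_valMinAbs_natCast (by omega)]
      · have := hpr p hp t ht
        rwa [add_sub_cancel_left, natAbs_valMinAbs_natCast (by omega)]
  · intro j i p hp t ht
    have h1 := hpr p hp t ht
    simp only [circulant, Sym2.lift_mk, Equiv.symm_apply_apply]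
    rw [sub_add_cancel_left, ZMod.natAbs_valMinAbs_neg, natAbs_valMinAbs_natCast (by omega),
      level_eq_iff hr h1.1]
    rw [Finset.mem_Icc] at hp ht
    exact ⟨hp.1, ht.1, ht.2⟩
  · intro j j' i i' hj hadj
    simp only [circulant, Equiv.symm_apply_apply] at hadj
    exact absurd hadj.1 hj
  · rw [circulant_weightDegree hr h.one_le_level hD, mul_comm, h.half_ρ_mul_two]

/-! ### Supports in the model and their number. -/

/-- The disjoint union of the paths formed by the residue classes modulo `g` in `{0, …, s - 1}`. -/
def residuePaths (s g : ℕ) (hg : 0 < g) : SimpleGraph (Fin s) where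
  Adj k k' := (k' : ℕ) = k + g ∨ (k : ℕ) = k' + g
  symm := ⟨fun _ _ h => h.symm⟩
  loopless := ⟨fun k h => by omega⟩

lemma residuePaths_reachable_mod {s g : ℕ} {hg : 0 < g} {k k' : Fin s}
    (h : (residuePaths s g hg).Reachable k k') : (k : ℕ) % g = k' % g := by
  obtain ⟨w⟩ := h
  induction w with
  | nil => rfl
  | cons h _ ih =>
    rw [← ih]
    rcases h with h | h <;> rw [h, Nat.add_mod_right]

lemma residuePaths_reachable {s g : ℕ} (hg : 0 < g) (hs : g < s) (n : ℕ) (hn : n < s) :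
    (residuePaths s g hg).Reachable ⟨n % g, (Nat.mod_lt _ hg).trans hs⟩ ⟨n, hn⟩ := by
  induction n using Nat.strong_induction_on with
  | _ n ih =>
    by_cases h : n < g
    · simp only [Nat.mod_eq_of_lt h]
      exact SimpleGraph.Reachable.refl _
    · push Not at h
      have h1 := ih (n - g) (by omega) (by omega)
      simp only [← Nat.mod_eq_sub_mod h] at h1
      refine h1.trans (SimpleGraph.Adj.reachable (Or.inl ?_))
      simp; omega

/-- Passing to a spanning forest with the same reachability avoids proving that the paths are
acyclic. Components are then residue classes modulo `g`, represented by `0, …, g - 1`. -/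
lemma exists_residue_forest {s g : ℕ} (hg : 0 < g) (hs : g < s) :
    ∃ T ≤ residuePaths s g hg, T.IsAcyclic ∧ Nat.card T.ConnectedComponent = g := by
  obtain ⟨T, hT, hac, hreach⟩ := (residuePaths s g hg).exists_isAcyclic_reachable_eq_le
  refine ⟨T, hT, hac, ?_⟩
  have hbij : Function.Bijective
      (fun j : Fin g => T.connectedComponentMk ⟨j, j.2.trans hs⟩) := by
    constructor
    · intro j j' h
      have h1 := SimpleGraph.ConnectedComponent.exact h
      rw [hreach] at h1
      have h2 := residuePaths_reachable_mod h1
      simp only [Nat.mod_eq_of_lt j.2, Nat.mod_eq_of_lt j'.2] at h2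
      exact Fin.ext h2
    · intro c
      induction c using SimpleGraph.ConnectedComponent.ind with
      | _ k =>
        refine ⟨⟨k % g, Nat.mod_lt _ hg⟩, SimpleGraph.ConnectedComponent.sound ?_⟩
        rw [hreach]
        exact residuePaths_reachable hg hs k k.2
  rw [← Nat.card_eq_of_bijective _ hbij, Nat.card_fin]

section Construction

variable {d s g B ρ : ℕ} {node : Fin g × ZMod (d / g) ≃ Fin d} {G : WeightedGraph d}

lemma IsConstruction.adj_succ (hG : IsConstruction s g B ρ node G) (h : Admissible d s g B ρ)
    (j : Fin g) (i : ZMod (d / g)) : G.graph.Adj (node (j, i)) (node (j, i + 1)) := by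
  rw [hG.adj_iff]
  refine ⟨1, Finset.mem_Icc.2 ⟨le_rfl, h.one_le_level⟩, 1, ?_, ?_⟩
  · simpa using h.one_le_half_ρ
  · simp

lemma IsConstruction.weight_succ (hG : IsConstruction s g B ρ node G) (h : Admissible d s g B ρ)
    (j : Fin g) (i : ZMod (d / g)) : G.weight s(node (j, i), node (j, i + 1)) = 1 := by
  have := hG.weight_eq j i 1 (Finset.mem_Icc.2 ⟨le_rfl, h.one_le_level⟩) 1
    (by simpa using h.one_le_half_ρ)
  simpa using this

/-- Every node lies in a support of the weighted graph model. -/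
lemma IsConstruction.exists_mem_model (hG : IsConstruction s g B ρ node G)
    (h : Admissible d s g B ρ) (v : Fin d) : ∃ S ∈ G.model s g B, v ∈ S := by
  obtain ⟨⟨j₀, i₀⟩, rfl⟩ := node.surjective v
  have hg := h.g_pos
  have : NeZero (d / g) := ⟨h.group_pos.ne'⟩
  -- Nodes are dealt to the groups in turn, each group starting at index `i₀`. Thus `φ k` and `φ (k
  -- + g)` are consecutive in one group and joined with weight `1`, and the given node is `φ j₀`.
  set φ : ℕ → Fin d := fun k => node (⟨k % g, Nat.mod_lt _ hg⟩, i₀ + ((k / g : ℕ) : ZMod (d / g)))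
    with hφ
  -- As `s ≤ d`, no group is wrapped around, which makes `φ` injective below `s`.
  have hdiv : ∀ k < s, k / g < d / g := fun k hk => by
    rw [Nat.div_lt_iff_lt_mul hg, h.group_mul]
    exact hk.trans_le h.s_le_d
  have hinj : ∀ k < s, ∀ k' < s, φ k = φ k' → k = k' := by
    intro k hk k' hk' he
    have he := node.injective he
    rw [Prod.mk.injEq, Fin.mk.injEq, add_right_inj, ZMod.natCast_eq_natCast_iff',
      Nat.mod_eq_of_lt (hdiv k hk), Nat.mod_eq_of_lt (hdiv k' hk')] at he
    rw [← Nat.div_add_mod k g, he.1, he.2, Nat.div_add_mod]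
  have hsucc : ∀ k, φ (k + g) = node (⟨k % g, Nat.mod_lt _ hg⟩,
      i₀ + ((k / g : ℕ) : ZMod (d / g)) + 1) := by
    intro k
    simp only [hφ, Nat.add_mod_right, Nat.add_div_right k hg, Nat.cast_add,
      Nat.cast_one, add_assoc]
  have hadj : ∀ k, G.graph.Adj (φ k) (φ (k + g)) := fun k => by
    rw [hsucc]; exact hG.adj_succ h _ _
  have hweight : ∀ k, G.weight s(φ k, φ (k + g)) = 1 := fun k => by
    rw [hsucc]; exact hG.weight_succ h _ _
  obtain ⟨T, hT, hac, hcc⟩ := exists_residue_forest hg h.g_lt_s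
  let f : SimpleGraph.Copy T G.graph := ⟨⟨fun k => φ k, fun {k k'} hk => by
    rcases hT hk with e | e
    · rw [e]; exact hadj _
    · rw [e]; exact (hadj _).symm⟩, fun k k' e => Fin.ext (hinj k k.2 k' k'.2 e)⟩
  refine ⟨(Finset.range s).image φ, ⟨?_, f.toSubgraph, ?_, ?_, ?_, ?_⟩, ?_⟩
  · rw [Finset.card_image_of_injOn, Finset.card_range]
    intro k hk k' hk' e
    exact hinj k (by simpa using hk) k' (by simpa using hk') e
  · ext w
    simp only [SimpleGraph.Subgraph.map_verts, SimpleGraph.Subgraph.verts_top, Set.image_univ,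
      Set.mem_range, Finset.coe_image, Finset.coe_range, Set.mem_image, Set.mem_Iio]
    exact ⟨fun ⟨k, hk⟩ => ⟨k, k.2, hk⟩, fun ⟨k, hk, e⟩ => ⟨⟨k, hk⟩, e⟩⟩
  · exact f.isoToSubgraph.isAcyclic_iff.1 hac
  · rw [← Nat.card_congr f.isoToSubgraph.connectedComponentEquiv, hcc]
  -- Every edge joins `φ k` to `φ (k + g)` with `k < s - g`, so there are at most `s - g ≤ B` edges,
  -- all of weight `1`.
  · have hedge : f.toSubgraph.edgeSet ⊆
        (((Finset.range (s - g)).image fun k => s(φ k, φ (k + g)) : Finset _) : Set _) := by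
      intro e
      induction e using Sym2.ind with
      | _ u w =>
        rw [SimpleGraph.Subgraph.mem_edgeSet, SimpleGraph.Subgraph.map_adj]
        rintro ⟨k, k', hkk, rfl, rfl⟩
        rw [Finset.mem_coe, Finset.mem_image]
        have hk := k.2
        have hk' := k'.2
        rcases hT hkk with e | e
        · refine ⟨k, Finset.mem_range.2 (by omega), ?_⟩
          rw [← e]; rfl
        · refine ⟨k', Finset.mem_range.2 (by omega), ?_⟩
          rw [← e, Sym2.eq_swap]; rfl
    have hone : ∀ e ∈ f.toSubgraph.edgeSet, G.weight e = 1 := by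
      intro e he
      obtain ⟨k, -, rfl⟩ := Finset.mem_image.1 (hedge he)
      exact hweight k
    rw [finsum_mem_congr rfl hone, finsum_one]
    calc f.toSubgraph.edgeSet.ncard ≤ _ := Set.ncard_le_ncard hedge (Finset.finite_toSet _)
      _ ≤ s - g := by
        rw [Set.ncard_coe_finset]
        exact Finset.card_image_le.trans (Finset.card_range _).le
      _ ≤ B := by
        rw [← h.level_mul]
        exact Nat.le_mul_of_pos_left _ h.one_le_level
  · rw [Finset.mem_image]
    refine ⟨j₀, Finset.mem_range.2 (j₀.2.trans h.g_lt_s), ?_⟩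
    simp [hφ, Nat.mod_eq_of_lt j₀.2, Nat.div_eq_of_lt j₀.2]

/-- The model has at least `d / s` elements. -/
lemma IsConstruction.le_mul_ncard_model (hG : IsConstruction s g B ρ node G)
    (h : Admissible d s g B ρ) : d ≤ (G.model s g B).ncard * s := by
  classical
  have hfin : (G.model s g B).Finite := Set.toFinite _
  have hcov : (Finset.univ : Finset (Fin d)) ⊆ hfin.toFinset.biUnion id := by
    intro v _
    obtain ⟨S, hS, hv⟩ := hG.exists_mem_model h v
    exact Finset.mem_biUnion.2 ⟨S, hfin.mem_toFinset.2 hS, hv⟩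
  calc d = (Finset.univ : Finset (Fin d)).card := (Finset.card_fin d).symm
    _ ≤ _ := Finset.card_le_card hcov
    _ ≤ hfin.toFinset.card * s := Finset.card_biUnion_le_card_mul _ _ _ fun S hS =>
        (hfin.mem_toFinset.1 hS).1.le
    _ = _ := by rw [Set.ncard_eq_toFinset_card _ hfin]

end Construction

/-! ### Separation, size and norms of the two-level family. -/

/-- The vector with the values `a + δ` on `T`, `a` on `S \ T` and `0` elsewhere. -/
def twoLevelVector {d : ℕ} (a δ : ℝ) (S T : Finset (Fin d)) : EuclideanSpace ℝ (Fin d) :=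
  WithLp.toLp 2 fun i => if i ∈ T then a + δ else if i ∈ S then a else 0

section TwoLevel

variable {d : ℕ} {a δ : ℝ} {S T S' T' : Finset (Fin d)}

lemma twoLevelVector_apply (i : Fin d) :
    twoLevelVector a δ S T i = if i ∈ T then a + δ else if i ∈ S then a else 0 := rfl

/-- Only the cardinalities of `S` and `T` enter; this is why the ensemble has so few norms. -/
lemma norm_sq_twoLevelVector (hT : T ⊆ S) :
    ‖twoLevelVector a δ S T‖ ^ 2 = T.card * (a + δ) ^ 2 + (S.card - T.card) * a ^ 2 := by
  rw [EuclideanSpace.real_norm_sq_eq]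
  have : ∀ i, twoLevelVector a δ S T i ^ 2 =
      (if i ∈ T then (a + δ) ^ 2 - a ^ 2 else 0) + if i ∈ S then a ^ 2 else 0 := by
    intro i
    rw [twoLevelVector_apply]
    by_cases h1 : i ∈ T
    · simp [h1, hT h1]
    · by_cases h2 : i ∈ S <;> simp [h1, h2]
  simp only [this, Finset.sum_add_distrib, Finset.sum_ite_mem, Finset.univ_inter,
    Finset.sum_const, nsmul_eq_mul]
  ring

lemma abs_sub_le_norm_sub (x y : EuclideanSpace ℝ (Fin d)) (i : Fin d) :
    |x i - y i| ≤ ‖x - y‖ := by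
  simpa using PiLp.norm_apply_le (x - y) i

/-- On a common support some coordinate differs by exactly `δ`. Different supports of equal size
each have a coordinate outside the other, and these two coordinates contribute at least `2 a ^ 2 = δ
^ 2`. -/
lemma le_norm_sub_twoLevelVector (ha : 0 < a) (hδ : 0 < δ) (had : δ ^ 2 = 2 * a ^ 2)
    (hT : T ⊆ S) (hT' : T' ⊆ S') (hcard : S.card = S'.card) (hne : S ≠ S' ∨ T ≠ T') :
    δ ≤ ‖twoLevelVector a δ S T - twoLevelVector a δ S' T'‖ := by
  by_cases hS : S = S'
  · subst hS
    have hTT : T ≠ T' := by simpa using hne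
    obtain ⟨i, hi⟩ : ∃ i, ¬ (i ∈ T ↔ i ∈ T') := by
      by_contra hcon
      push Not at hcon
      exact hTT (Finset.ext hcon)
    refine le_trans ?_ (abs_sub_le_norm_sub _ _ i)
    rw [twoLevelVector_apply, twoLevelVector_apply]
    by_cases h1 : i ∈ T
    · have h2 : i ∉ T' := fun h2 => hi ⟨fun _ => h2, fun _ => h1⟩
      simp [h1, h2, hT h1, abs_of_pos hδ]
    · have h2 : i ∈ T' := by tauto
      simp [h1, h2, hT' h2, abs_of_pos hδ]
  · obtain ⟨i, hi, hi'⟩ : ∃ i ∈ S, i ∉ S' := by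
      by_contra! hcon
      exact hS (Finset.eq_of_subset_of_card_le hcon hcard.ge)
    obtain ⟨j, hj, hj'⟩ : ∃ j ∈ S', j ∉ S := by
      by_contra! hcon
      exact hS (Finset.eq_of_subset_of_card_le hcon hcard.le).symm
    have hij : i ≠ j := fun e => hj' (e ▸ hi)
    set x := twoLevelVector a δ S T with hx
    set y := twoLevelVector a δ S' T' with hy
    have hxi : a ≤ (x - y) i := by
      have h1 : i ∉ T' := fun h => hi' (hT' h)
      simp only [hx, hy, PiLp.sub_apply, twoLevelVector_apply, hi, hi', h1, if_true, if_false]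
      split_ifs <;> linarith
    have hxj : (x - y) j ≤ -a := by
      have h1 : j ∉ T := fun h => hj' (hT h)
      simp only [hx, hy, PiLp.sub_apply, twoLevelVector_apply, hj, hj', h1, if_true, if_false]
      split_ifs <;> linarith
    refine (sq_le_sq₀ hδ.le (norm_nonneg _)).1 ?_
    rw [EuclideanSpace.real_norm_sq_eq, had]
    calc 2 * a ^ 2 ≤ (x - y) i ^ 2 + (x - y) j ^ 2 := by nlinarith
      _ = ∑ l ∈ {i, j}, (x - y) l ^ 2 := by rw [Finset.sum_pair hij]
      _ ≤ ∑ l, (x - y) l ^ 2 :=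
        Finset.sum_le_univ_sum_of_nonneg fun l => sq_nonneg _

end TwoLevel

open Classical in
/-- The two-level vectors supported on the members of `M`. -/
def twoLevelFinset {d : ℕ} (M : Finset (Finset (Fin d))) (a δ : ℝ) :
    Finset (EuclideanSpace ℝ (Fin d)) :=
  (M.sigma fun S => S.powerset).image fun p => twoLevelVector a δ p.1 p.2

section Family

variable {d s : ℕ} {a δ : ℝ} {M : Finset (Finset (Fin d))}

lemma mem_twoLevelFinset {x : EuclideanSpace ℝ (Fin d)} :
    x ∈ twoLevelFinset M a δ ↔ ∃ S ∈ M, ∃ T ⊆ S, twoLevelVector a δ S T = x := by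
  simp only [twoLevelFinset, Finset.mem_image, Finset.mem_sigma, Finset.mem_powerset, Sigma.exists]
  exact ⟨fun ⟨S, T, ⟨h1, h2⟩, h3⟩ => ⟨S, h1, T, h2, h3⟩,
    fun ⟨S, h1, T, h2, h3⟩ => ⟨S, T, ⟨h1, h2⟩, h3⟩⟩

lemma card_twoLevelFinset (hM : ∀ S ∈ M, S.card = s) (ha : 0 < a) (hδ : 0 < δ)
    (had : δ ^ 2 = 2 * a ^ 2) : (twoLevelFinset M a δ).card = M.card * 2 ^ s := by
  classical
  unfold twoLevelFinset
  rw [Finset.card_image_of_injOn, Finset.card_sigma]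
  · simp only [Finset.card_powerset]
    rw [Finset.sum_congr rfl fun S hS => by rw [hM S hS], Finset.sum_const, smul_eq_mul]
  · rintro ⟨S, T⟩ hp ⟨S', T'⟩ hp' he
    simp only [Finset.coe_sigma, Set.mem_sigma_iff, Finset.mem_coe, Finset.mem_powerset] at hp hp'
    by_contra hne
    have hne' : S ≠ S' ∨ T ≠ T' := by
      by_contra! hcon
      exact hne (by rw [hcon.1, hcon.2])
    have := le_norm_sub_twoLevelVector ha hδ had hp.2 hp'.2
      ((hM S hp.1).trans (hM S' hp'.1).symm) hne'
    simp only at he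
    rw [he, sub_self, norm_zero] at this
    linarith

lemma le_norm_sub_of_mem_twoLevelFinset (hM : ∀ S ∈ M, S.card = s) (ha : 0 < a) (hδ : 0 < δ)
    (had : δ ^ 2 = 2 * a ^ 2) {x y : EuclideanSpace ℝ (Fin d)} (hx : x ∈ twoLevelFinset M a δ)
    (hy : y ∈ twoLevelFinset M a δ) (hxy : x ≠ y) : δ ≤ ‖x - y‖ := by
  obtain ⟨S, hS, T, hT, rfl⟩ := mem_twoLevelFinset.1 hx
  obtain ⟨S', hS', T', hT', rfl⟩ := mem_twoLevelFinset.1 hy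
  refine le_norm_sub_twoLevelVector ha hδ had hT hT' ((hM S hS).trans (hM S' hS').symm) ?_
  by_contra! hcon
  exact hxy (by rw [hcon.1, hcon.2])

lemma card_norm_twoLevelFinset_le (hM : ∀ S ∈ M, S.card = s) :
    ((twoLevelFinset M a δ).image norm).card ≤ s + 1 := by
  have hsub : (twoLevelFinset M a δ).image norm ⊆
      (Finset.range (s + 1)).image fun t : ℕ => √(t * (a + δ) ^ 2 + ((s : ℝ) - t) * a ^ 2) := by
    intro r hr
    obtain ⟨x, hx, rfl⟩ := Finset.mem_image.1 hr
    obtain ⟨S, hS, T, hT, rfl⟩ := mem_twoLevelFinset.1 hx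
    refine Finset.mem_image.2 ⟨T.card, ?_, ?_⟩
    · rw [Finset.mem_range, Nat.lt_succ_iff, ← hM S hS]
      exact Finset.card_le_card hT
    · rw [← hM S hS, ← norm_sq_twoLevelVector hT, Real.sqrt_sq (norm_nonneg _)]
  exact (Finset.card_le_card hsub).trans (Finset.card_image_le.trans (Finset.card_range _).le)

end Family

lemma ensemble_eq {d s g B : ℕ} (G : WeightedGraph d) (C₀ σ ε : ℝ)
    {M : Finset (Finset (Fin d))} (hM : (M : Set (Finset (Fin d))) = G.model s g B) :
    ensemble G s g B C₀ σ ε = (twoLevelFinset M (C₀ * σ * √d / √(2 * (1 - ε)))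
      (C₀ * σ * √d / √(1 - ε)) : Set (EuclideanSpace ℝ (Fin d))) := by
  ext x
  rw [Finset.mem_coe, mem_twoLevelFinset, ensemble, Set.mem_ofPred_eq]
  generalize C₀ * σ * √d / √(1 - ε) = δ
  generalize C₀ * σ * √d / √(2 * (1 - ε)) = a
  constructor
  · rintro ⟨S, hS, h0, h1⟩
    rw [← hM, Finset.mem_coe] at hS
    -- The upper set is recovered as the coordinates of `S` that do not have the lower value.
    refine ⟨S, hS, S.filter fun i => x i ≠ a, Finset.filter_subset _ _, ?_⟩
    ext i
    simp only [twoLevelVector_apply, Finset.mem_filter]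
    by_cases hi : i ∈ S
    · by_cases hia : x i = a
      · simp [hi, hia]
      · simpa [hi, hia] using ((h1 i hi).resolve_left hia).symm
    · simp [hi, h0 i hi]
  · rintro ⟨S, hS, T, hT, rfl⟩
    rw [← Finset.mem_coe, hM] at hS
    refine ⟨S, hS, fun i hi => ?_, fun i hi => ?_⟩
    · have : i ∉ T := fun h => hi (hT h)
      simp [twoLevelVector_apply, hi, this]
    · by_cases h : i ∈ T <;> simp [twoLevelVector_apply, hi, h]

/-! ### The response law depends only on the norm. -/

/-- A linear form in independent standard Gaussians is Gaussian, with variance the squared norm of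
its coefficient vector. -/
lemma map_dotProduct_pi_gaussianReal {d : ℕ} (β : EuclideanSpace ℝ (Fin d)) :
    (Measure.pi fun _ : Fin d => gaussianReal 0 1).map (fun x => x ⬝ᵥ WithLp.ofLp β) =
      gaussianReal 0 (‖β‖ ^ 2).toNNReal := by
  have hm : Measurable fun x : Fin d → ℝ => x ⬝ᵥ WithLp.ofLp β := by
    unfold dotProduct; fun_prop
  have : IsProbabilityMeasure ((Measure.pi fun _ : Fin d => gaussianReal 0 1).map
      (fun x => x ⬝ᵥ WithLp.ofLp β)) := Measure.isProbabilityMeasure_map hm.aemeasurable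
  refine Measure.ext_of_charFun (funext fun t => ?_)
  -- The characteristic function of the linear form at `t` is that of the Gaussian vector at `t •
  -- β`, which factorizes over the coordinates.
  have h1 : charFun ((Measure.pi fun _ : Fin d => gaussianReal 0 1).map
      (fun x => x ⬝ᵥ WithLp.ofLp β)) t =
      charFun ((Measure.pi fun _ : Fin d => gaussianReal 0 1).map (WithLp.toLp 2)) (t • β) := by
    rw [charFun_apply, charFun_apply, integral_map hm.aemeasurable (by fun_prop),
      integral_map (by fun_prop) (by fun_prop)]
    congr with x
    rw [inner_smul_right, EuclideanSpace.inner_eq_star_dotProduct]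
    simp [dotProduct_comm]
  rw [h1, charFun_pi, charFun_gaussianReal]
  simp_rw [charFun_gaussianReal]
  rw [← Complex.exp_sum, Real.coe_toNNReal _ (sq_nonneg _), EuclideanSpace.real_norm_sq_eq]
  congr 1
  push_cast
  simp only [PiLp.smul_apply, smul_eq_mul]
  push_cast
  simp only [mul_zero, zero_mul, zero_sub, Finset.sum_neg_distrib, Finset.sum_mul, Finset.sum_div]
  congr 1
  refine Finset.sum_congr rfl fun i _ => ?_
  simp
  ring

/-- The joint law of the design and the noise. -/
def designNoiseLaw (d n : ℕ) (σ : ℝ) : Measure ((Fin n → Fin d → ℝ) × (Fin n → ℝ)) :=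
  (Measure.pi fun _ : Fin n => Measure.pi fun _ : Fin d => gaussianReal 0 1).prod
    (Measure.pi fun _ : Fin n => gaussianReal 0 (σ ^ 2).toNNReal)

instance (d n : ℕ) (σ : ℝ) : IsProbabilityMeasure (designNoiseLaw d n σ) := by
  unfold designNoiseLaw; infer_instance

/-- The law of the linear response at a fixed parameter depends only on the norm of the parameter. -/
lemma map_linearResponse {d n : ℕ} (σ : ℝ) (β : EuclideanSpace ℝ (Fin d)) :
    (designNoiseLaw d n σ).map (fun w => linearResponse (β, w)) =
      ((Measure.pi fun _ : Fin n => gaussianReal 0 (‖β‖ ^ 2).toNNReal).prod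
        (Measure.pi fun _ : Fin n => gaussianReal 0 (σ ^ 2).toNNReal)).map (fun u => u.1 + u.2) := by
  have hm : Measurable fun x : Fin d → ℝ => x ⬝ᵥ WithLp.ofLp β := by
    unfold dotProduct; fun_prop
  have hX : (Measure.pi fun _ : Fin n => Measure.pi fun _ : Fin d => gaussianReal 0 1).map
      (fun X i => X i ⬝ᵥ WithLp.ofLp β) =
      Measure.pi fun _ : Fin n => gaussianReal 0 (‖β‖ ^ 2).toNNReal := by
    rw [← map_dotProduct_pi_gaussianReal]
    have : IsProbabilityMeasure ((Measure.pi fun _ : Fin d => gaussianReal 0 1).map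
      (fun x => x ⬝ᵥ WithLp.ofLp β)) := Measure.isProbabilityMeasure_map hm.aemeasurable
    exact Measure.pi_map_pi fun _ => hm.aemeasurable
  have hmX : Measurable fun (X : Fin n → Fin d → ℝ) i => X i ⬝ᵥ WithLp.ofLp β :=
    measurable_pi_lambda _ fun i => hm.comp (measurable_pi_apply i)
  rw [← hX]
  have he := (Measure.map_id (μ := Measure.pi fun _ : Fin n =>
    gaussianReal 0 (σ ^ 2).toNNReal)).symm
  conv_rhs => rw [he]
  rw [Measure.map_prod_map _ _ hmX measurable_id, Measure.map_map (by fun_prop) (by fun_prop)]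
  rfl

/-- The law of the observed linear response for a parameter of norm `r`. -/
def responseLaw (n : ℕ) (σ r : ℝ) : Measure (Fin n → ℝ) :=
  ((Measure.pi fun _ : Fin n => gaussianReal 0 (r ^ 2).toNNReal).prod
    (Measure.pi fun _ : Fin n => gaussianReal 0 (σ ^ 2).toNNReal)).map (fun u => u.1 + u.2)

instance (n : ℕ) (σ r : ℝ) : IsProbabilityMeasure (responseLaw n σ r) :=
  Measure.isProbabilityMeasure_map (by fun_prop)

/-! ### Probability of a close estimate and of large noise. -/

lemma lintegral_uniformOn_finset {Ω : Type*} [MeasurableSpace Ω] [MeasurableSingletonClass Ω]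
    (A : Finset Ω) (F : Ω → ENNReal) :
    ∫⁻ x, F x ∂(uniformOn (A : Set Ω)) = (A.card : ENNReal)⁻¹ * ∑ x ∈ A, F x := by
  rw [uniformOn, ProbabilityTheory.cond, lintegral_smul_measure, Measure.count_apply_finset,
    lintegral_finset]
  simp

/-- An estimator that only sees the response identifies, for each value of the norm, at most one
parameter of a separated family with certainty. -/
lemma jointLaw_close_le {d n : ℕ} {A : Finset (EuclideanSpace ℝ (Fin d))}
    [IsProbabilityMeasure (uniformOn (A : Set (EuclideanSpace ℝ (Fin d))))]
    {σ δ : ℝ} (hsep : ∀ x ∈ A, ∀ y ∈ A, x ≠ y → δ ≤ ‖x - y‖)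
    (f : (Fin n → ℝ) → (Fin n → ℝ)) (hf : Measurable f)
    (κ : Kernel (Fin n → ℝ) (EuclideanSpace ℝ (Fin d))) [IsMarkovKernel κ] :
    jointLaw n (A : Set _) σ f hf κ {x | ‖x.1.1 - x.2‖ < δ / 2} ≤
      (A.card : ENNReal)⁻¹ * (A.image norm).card := by
  have hms : MeasurableSet {x : Outcome d n × EuclideanSpace ℝ (Fin d) | ‖x.1.1 - x.2‖ < δ / 2} :=
    measurableSet_lt (by fun_prop) measurable_const
  have hmb : ∀ β : EuclideanSpace ℝ (Fin d),
      MeasurableSet {b : EuclideanSpace ℝ (Fin d) | ‖β - b‖ < δ / 2} := fun β =>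
    measurableSet_lt (by fun_prop) measurable_const
  have : SFinite (sourceLaw n (A : Set (EuclideanSpace ℝ (Fin d))) σ) := by
    unfold sourceLaw; infer_instance
  rw [jointLaw, Measure.compProd_apply hms]
  have hs : sourceLaw n (A : Set (EuclideanSpace ℝ (Fin d))) σ =
    (uniformOn (A : Set (EuclideanSpace ℝ (Fin d)))).prod (designNoiseLaw d n σ) := rfl
  rw [hs, lintegral_prod _ (Kernel.measurable_kernel_prodMk_left hms).aemeasurable,
    lintegral_uniformOn_finset]
  gcongr
  have hinner : ∀ β ∈ A, ∫⁻ w, (κ.comap (fun ω : Outcome d n => f (linearResponse ω))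
        (hf.comp measurable_linearResponse)) (β, w)
        (Prod.mk ((β, w) : Outcome d n) ⁻¹' {x | ‖x.1.1 - x.2‖ < δ / 2}) ∂(designNoiseLaw d n σ) =
      ∫⁻ y, κ (f y) {b | ‖β - b‖ < δ / 2} ∂(responseLaw n σ ‖β‖) := by
    intro β _
    rw [responseLaw, ← map_linearResponse, lintegral_map]
    · rfl
    · exact (κ.measurable_coe (hmb β)).comp hf
    · exact measurable_linearResponse.comp (by fun_prop)
  have hmκ : ∀ β : EuclideanSpace ℝ (Fin d),
      Measurable fun y => κ (f y) {b | ‖β - b‖ < δ / 2} := fun β =>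
    (κ.measurable_coe (hmb β)).comp hf
  -- Parameters are grouped by norm: within a group all integrals are against one response law, so
  -- the sum moves inside the integral.
  rw [Finset.sum_congr rfl hinner,
    ← Finset.sum_fiberwise_of_maps_to (g := norm) (t := A.image norm)
      fun β hβ => Finset.mem_image_of_mem _ hβ]
  rw [Finset.card_eq_sum_ones, Nat.cast_sum, Nat.cast_one]
  refine Finset.sum_le_sum fun r _ => ?_
  rw [Finset.sum_congr rfl fun β hβ => by rw [(Finset.mem_filter.1 hβ).2],
    ← lintegral_finsetSum _ fun β _ => hmκ β]
  calc ∫⁻ y, ∑ β ∈ A with ‖β‖ = r, κ (f y) {b | ‖β - b‖ < δ / 2} ∂(responseLaw n σ r)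
      ≤ ∫⁻ y, 1 ∂(responseLaw n σ r) := by
        refine lintegral_mono fun y => ?_
        -- For a fixed response the balls of radius `δ / 2` are disjoint, so the kernel gives them
        -- total mass at most `1`.
        rw [← measure_biUnion_finset _ fun β _ => hmb β]
        · exact prob_le_one
        · intro x hx y hy hxy
          refine Set.disjoint_left.2 fun b hb hb' => ?_
          have h1 := hsep x (Finset.mem_filter.1 hx).1 y (Finset.mem_filter.1 hy).1 hxy
          have h2 : ‖x - y‖ ≤ ‖x - b‖ + ‖y - b‖ := by
            rw [norm_sub_rev y b]; exact norm_sub_le_norm_sub_add_norm_sub x b y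
          have hb : ‖x - b‖ < δ / 2 := hb
          have hb' : ‖y - b‖ < δ / 2 := hb'
          linarith
    _ = 1 := by simp

lemma lintegral_sq_gaussianReal (v : NNReal) :
    ∫⁻ x, ENNReal.ofReal (x ^ 2) ∂(gaussianReal 0 v) = v := by
  have hmem : MemLp (fun x : ℝ => x) 2 (gaussianReal 0 v) := memLp_id_gaussianReal 2
  rw [← ofReal_integral_eq_lintegral_ofReal hmem.integrable_sq (ae_of_all _ fun x => sq_nonneg x)]
  have h := variance_fun_id_gaussianReal (μ := 0) (v := v)
  rw [variance_of_integral_eq_zero (by fun_prop) integral_id_gaussianReal] at h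
  rw [h, ENNReal.ofReal_coe_nnreal]

/-- Markov's inequality for the squared norm of the noise. -/
lemma jointLaw_noise_le {d n : ℕ} (A : Set (EuclideanSpace ℝ (Fin d)))
    [IsProbabilityMeasure (uniformOn A)] (σ : ℝ) {t : ℝ} (ht : 0 < t)
    (f : (Fin n → ℝ) → (Fin n → ℝ)) (hf : Measurable f)
    (κ : Kernel (Fin n → ℝ) (EuclideanSpace ℝ (Fin d))) [IsMarkovKernel κ] :
    jointLaw n A σ f hf κ
      {x | t ≤ ‖(WithLp.toLp 2 x.1.2.2 : EuclideanSpace ℝ (Fin n))‖} ≤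
      ENNReal.ofReal (n * σ ^ 2 / t ^ 2) := by
  set P : Measure (Fin n → ℝ) := Measure.pi fun _ : Fin n => gaussianReal 0 (σ ^ 2).toNNReal with hP
  have hms : MeasurableSet {e : Fin n → ℝ | t ≤ ‖(WithLp.toLp 2 e : EuclideanSpace ℝ (Fin n))‖} :=
    measurableSet_le measurable_const (by fun_prop)
  have hlaw : (jointLaw n A σ f hf κ).map (fun x => x.1.2.2) = P := by
    have h1 : (jointLaw n A σ f hf κ).map Prod.fst = sourceLaw n A σ := by
      have : SFinite (sourceLaw n A σ) := by unfold sourceLaw; infer_instance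
      exact Measure.fst_compProd _ _
    have h2 : (sourceLaw n A σ).map (fun ω => ω.2.2) = P := by
      have : (fun ω : Outcome d n => ω.2.2) = Prod.snd ∘ Prod.snd := rfl
      rw [this, ← Measure.map_map measurable_snd measurable_snd]
      change ((sourceLaw n A σ).snd).snd = P
      rw [sourceLaw, Measure.snd_prod, Measure.snd_prod]
    rw [← h2, ← h1, Measure.map_map (by fun_prop) (by fun_prop)]
    rfl
  have hmap : jointLaw n A σ f hf κ
      {x | t ≤ ‖(WithLp.toLp 2 x.1.2.2 : EuclideanSpace ℝ (Fin n))‖} =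
      P {e | t ≤ ‖(WithLp.toLp 2 e : EuclideanSpace ℝ (Fin n))‖} := by
    rw [← hlaw, Measure.map_apply (by fun_prop) hms]
    rfl
  rw [hmap]
  have hint : ∫⁻ e, ENNReal.ofReal (‖(WithLp.toLp 2 e : EuclideanSpace ℝ (Fin n))‖ ^ 2) ∂P =
      ENNReal.ofReal (n * σ ^ 2) := by
    simp_rw [EuclideanSpace.real_norm_sq_eq]
    simp_rw [ENNReal.ofReal_sum_of_nonneg fun i _ => sq_nonneg _]
    rw [lintegral_finsetSum _ (by fun_prop)]
    have : ∀ i : Fin n, ∫⁻ e : Fin n → ℝ, ENNReal.ofReal (e i ^ 2) ∂P =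
        ENNReal.ofReal (σ ^ 2) := by
      intro i
      have hmp := measurePreserving_eval
        (fun _ : Fin n => gaussianReal 0 (σ ^ 2).toNNReal) i
      rw [hP, hmp.lintegral_comp (f := fun x => ENNReal.ofReal (x ^ 2)) (by fun_prop),
        lintegral_sq_gaussianReal]
      rfl
    simp only [this, Finset.sum_const, Finset.card_univ, Fintype.card_fin, nsmul_eq_mul]
    rw [ENNReal.ofReal_mul (Nat.cast_nonneg _), ENNReal.ofReal_natCast]
  rw [ENNReal.ofReal_div_of_pos (by positivity), ← hint]
  refine le_trans (measure_mono fun e he => ?_)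
    (meas_ge_le_lintegral_div (by fun_prop) (by simpa using ht.ne') ENNReal.ofReal_ne_top)
  exact ENNReal.ofReal_le_ofReal (pow_le_pow_left₀ ht.le he 2)

/-- The maximum of `s (s + 1) / 2 ^ s` is `3 / 2`, attained at `s = 2` and `s = 3`. -/
lemma two_mul_mul_succ_le (s : ℕ) : 2 * (s * (s + 1)) ≤ 3 * 2 ^ s := by
  rcases Nat.lt_or_ge s 3 with h | h
  · interval_cases s <;> norm_num
  · induction s, h using Nat.le_induction with
    | base => norm_num
    | succ s hs ih => rw [pow_succ]; nlinarith

instance {d n : ℕ} (A : Set (EuclideanSpace ℝ (Fin d))) [IsProbabilityMeasure (uniformOn A)] (σ : ℝ)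
    (f : (Fin n → ℝ) → (Fin n → ℝ)) (hf : Measurable f)
    (κ : Kernel (Fin n → ℝ) (EuclideanSpace ℝ (Fin d))) [IsMarkovKernel κ] :
    IsProbabilityMeasure (jointLaw n A σ f hf κ) := by
  have : IsProbabilityMeasure (sourceLaw n A σ) := by unfold sourceLaw; infer_instance
  unfold jointLaw; infer_instance

/-! ### Combining the bounds. -/

section Construction

variable {d s g B ρ : ℕ} {node : Fin g × ZMod (d / g) ≃ Fin d} {G : WeightedGraph d}

/-- The two-level description of the ensemble, together with its size. -/
lemma IsConstruction.exists_ensemble_eq (hG : IsConstruction s g B ρ node G)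
    (h : Admissible d s g B ρ) {C₀ σ ε : ℝ} (hC₀ : 0 < C₀) (hσ : 0 < σ) (hε : ε < 1) :
    ∃ A : Finset (EuclideanSpace ℝ (Fin d)), ensemble G s g B C₀ σ ε = A ∧
      (∀ x ∈ A, ∀ y ∈ A, x ≠ y → C₀ * σ * √d / √(1 - ε) ≤ ‖x - y‖) ∧
      2 * d * (A.image norm).card ≤ 3 * A.card ∧ 0 < A.card := by
  have hd : (0 : ℝ) < d := by exact_mod_cast h.d_pos
  have hε' : 0 < 1 - ε := by linarith
  set δ := C₀ * σ * √d / √(1 - ε) with hδ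
  set a := C₀ * σ * √d / √(2 * (1 - ε)) with ha
  have hδ0 : 0 < δ := by positivity
  have ha0 : 0 < a := by positivity
  have had : δ ^ 2 = 2 * a ^ 2 := by
    rw [hδ, ha, div_pow, div_pow, Real.sq_sqrt hε'.le, Real.sq_sqrt (by positivity)]
    field_simp
  have hfin : (G.model s g B).Finite := Set.toFinite _
  set M := hfin.toFinset with hM
  have hMc : ∀ S ∈ M, S.card = s := fun S hS => (hfin.mem_toFinset.1 hS).1
  have hcard := card_twoLevelFinset hMc ha0 hδ0 had
  have hle : d ≤ M.card * s := by
    rw [hM, ← Set.ncard_eq_toFinset_card _ hfin]; exact hG.le_mul_ncard_model h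
  refine ⟨twoLevelFinset M a δ, ensemble_eq G C₀ σ ε hfin.coe_toFinset,
    fun x hx y hy hxy => le_norm_sub_of_mem_twoLevelFinset hMc ha0 hδ0 had hx hy hxy, ?_, ?_⟩
  · rw [hcard]
    -- Two counts meet here: `d ≤ |M| * s` from the covering by supports, and at most `s + 1` norms.
    calc 2 * d * ((twoLevelFinset M a δ).image norm).card ≤ 2 * (M.card * s) * (s + 1) := by
          gcongr
          exact card_norm_twoLevelFinset_le hMc
      _ = M.card * (2 * (s * (s + 1))) := by ring
      _ ≤ M.card * (3 * 2 ^ s) := Nat.mul_le_mul_left _ (two_mul_mul_succ_le s)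
      _ = 3 * (M.card * 2 ^ s) := by ring
  · rw [hcard]
    have : 0 < M.card := Nat.pos_of_mul_pos_right (h.d_pos.trans_le hle)
    positivity

/-- Outside the large-noise event `N` and the close-estimate event `K`, the error is at least `δ / 2
≥ C₀ σ √d / 2 ≥ C ‖e‖`. Their probabilities are at most `4 n / d ≤ 4 / 10` and `3 / (2 d) ≤ 15 /
100`, which leaves `45 / 100`. -/
theorem IsConstruction.le_errorEvent (hG : IsConstruction s g B ρ node G)
    (h : Admissible d s g B ρ) {C₀ σ ε : ℝ} (hC₀ : 0 < C₀) (hσ : 0 < σ) (hε0 : 0 < ε) (hε : ε < 1)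
    {n : ℕ} (hn : 20 * (n : ℝ) ≤ sampleBound d s g B ρ)
    (f : (Fin n → ℝ) → (Fin n → ℝ)) (hf : Measurable f)
    (κ : Kernel (Fin n → ℝ) (EuclideanSpace ℝ (Fin d))) [IsMarkovKernel κ]
    {C : ℝ} (hC : C ≤ C₀) :
    1 / 10 ≤ (jointLaw n (ensemble G s g B C₀ σ ε) σ f hf κ).real (errorEvent d n C) := by
  obtain ⟨A, hA, hsep, hcount, hpos⟩ := hG.exists_ensemble_eq h hC₀ hσ hε
  rw [hA]
  have : IsProbabilityMeasure (uniformOn (A : Set (EuclideanSpace ℝ (Fin d)))) :=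
    isProbabilityMeasure_uniformOn A.finite_toSet (Finset.card_pos.1 hpos)
  set μ := jointLaw n (A : Set (EuclideanSpace ℝ (Fin d))) σ f hf κ with hμ
  -- Without samples the noise norm is zero and the event is everything. Otherwise `n ≥ 1` forces `d
  -- ≥ 10`, which the bound on `K` needs.
  rcases Nat.eq_zero_or_pos n with rfl | hn0
  · have : errorEvent d 0 C = Set.univ := by
      refine Set.eq_univ_of_forall fun x => ?_
      have : ‖(WithLp.toLp 2 x.1.2.2 : EuclideanSpace ℝ (Fin 0))‖ = 0 := by
        rw [Subsingleton.elim (WithLp.toLp 2 x.1.2.2 : EuclideanSpace ℝ (Fin 0)) 0, norm_zero]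
      change C * _ ≤ _
      rw [this, mul_zero]
      exact norm_nonneg _
    rw [this, probReal_univ]
    norm_num
  have hd : (0 : ℝ) < d := by exact_mod_cast h.d_pos
  have hn1 : (1 : ℝ) ≤ n := by exact_mod_cast hn0
  have hnd : 10 * (n : ℝ) ≤ d := by have := h.sampleBound_le; linarith
  have hApos : (0 : ℝ) < A.card := by exact_mod_cast hpos
  set δ := C₀ * σ * √d / √(1 - ε) with hδ
  set N := {x : Outcome d n × EuclideanSpace ℝ (Fin d) |
    σ * √d / 2 ≤ ‖(WithLp.toLp 2 x.1.2.2 : EuclideanSpace ℝ (Fin n))‖} with hN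
  set K := {x : Outcome d n × EuclideanSpace ℝ (Fin d) | ‖x.1.1 - x.2‖ < δ / 2} with hK
  have hcover : (Set.univ : Set (Outcome d n × EuclideanSpace ℝ (Fin d))) ⊆
      errorEvent d n C ∪ (N ∪ K) := by
    intro x _
    by_contra hx
    simp only [Set.mem_union, not_or] at hx
    obtain ⟨h1, h2, h3⟩ := hx
    have h1 : ‖x.1.1 - x.2‖ < C * ‖(WithLp.toLp 2 x.1.2.2 : EuclideanSpace ℝ (Fin n))‖ :=
      not_le.1 h1
    have h2 : ‖(WithLp.toLp 2 x.1.2.2 : EuclideanSpace ℝ (Fin n))‖ < σ * √d / 2 := not_le.1 h2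
    have h3 : δ / 2 ≤ ‖x.1.1 - x.2‖ := not_lt.1 h3
    have h4 : C * ‖(WithLp.toLp 2 x.1.2.2 : EuclideanSpace ℝ (Fin n))‖ ≤ C₀ * (σ * √d / 2) :=
      (mul_le_mul_of_nonneg_right hC (norm_nonneg _)).trans
        (mul_le_mul_of_nonneg_left h2.le hC₀.le)
    have h5 : C₀ * σ * √d ≤ δ := by
      rw [hδ]
      refine le_div_self (by positivity) (Real.sqrt_pos.2 (by linarith)) ?_
      rw [Real.sqrt_le_one]
      linarith
    linarith
  have hNle : μ.real N ≤ 4 / 10 := by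
    refine ENNReal.toReal_le_of_le_ofReal (by norm_num)
      ((jointLaw_noise_le _ σ (by positivity) f hf κ).trans (ENNReal.ofReal_le_ofReal ?_))
    rw [div_pow, mul_pow, Real.sq_sqrt hd.le, div_le_iff₀ (by positivity)]
    nlinarith [sq_nonneg σ]
  have hKle : μ.real K ≤ 15 / 100 := by
    refine ENNReal.toReal_le_of_le_ofReal (by norm_num) ((jointLaw_close_le hsep f hf κ).trans ?_)
    rw [← ENNReal.ofReal_natCast, ← ENNReal.ofReal_natCast, ← ENNReal.ofReal_inv_of_pos hApos,
      ← ENNReal.ofReal_mul (by positivity)]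
    refine ENNReal.ofReal_le_ofReal ?_
    rw [inv_mul_le_iff₀ hApos]
    have hc : 2 * (d : ℝ) * (A.image norm).card ≤ 3 * A.card := by exact_mod_cast hcount
    have hc' : 2 * (10 : ℝ) * (A.image norm).card ≤ 2 * (d : ℝ) * (A.image norm).card := by
      gcongr; linarith
    linarith
  have htot : (1 : ℝ) ≤ μ.real (errorEvent d n C) + (μ.real N + μ.real K) := by
    calc (1 : ℝ) = μ.real Set.univ := probReal_univ.symm
      _ ≤ μ.real (errorEvent d n C ∪ (N ∪ K)) := measureReal_mono hcover
      _ ≤ μ.real (errorEvent d n C) + μ.real (N ∪ K) := measureReal_union_le _ _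
      _ ≤ _ := by gcongr; exact measureReal_union_le _ _
  linarith

end Construction

end GraphSparsity

end

theorem mainTheorem2
    (d s g B ρ n : ℕ → ℕ)
    (hadm : ∀ k, GraphSparsity.Admissible (d k) (s k) (g k) (B k) (ρ k))
    (hn : (fun k => (n k : ℝ)) =o[atTop]
      fun k => GraphSparsity.sampleBound (d k) (s k) (g k) (B k) (ρ k)) :
    (∀ k, ∃ (node : Fin (g k) × ZMod (d k / g k) ≃ Fin (d k))
        (G : GraphSparsity.WeightedGraph (d k)),
      GraphSparsity.IsConstruction (s k) (g k) (B k) (ρ k) node G) ∧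
    ∀ᶠ k in atTop,
      ∀ (node : Fin (g k) × ZMod (d k / g k) ≃ Fin (d k))
        (G : GraphSparsity.WeightedGraph (d k)),
        GraphSparsity.IsConstruction (s k) (g k) (B k) (ρ k) node G →
      ∀ C₀ σ ε : ℝ, 0 < C₀ → 0 < σ → 0 < ε → ε < 1 →
      ∀ (f : (Fin (n k) → ℝ) → (Fin (n k) → ℝ)) (hf : Measurable f)
        (κ : Kernel (Fin (n k) → ℝ) (EuclideanSpace ℝ (Fin (d k)))) [IsMarkovKernel κ],
      ∀ C : ℝ, 0 < C → C ≤ C₀ →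
        1 / 10 ≤ (GraphSparsity.jointLaw (n k)
          (GraphSparsity.ensemble G (s k) (g k) (B k) C₀ σ ε) σ f hf κ).real
            (GraphSparsity.errorEvent (d k) (n k) C) := by
  refine ⟨fun k => (hadm k).exists_isConstruction, ?_⟩
  -- The constant `1 / 20`, together with the bound `2 d` on the sample expression, yields `n ≤ d /
  -- 10`.
  filter_upwards [hn.bound (show (0 : ℝ) < 1 / 20 by norm_num)] with k hk
  intro node G hG C₀ σ ε hC₀ hσ hε0 hε f hf κ _ C _ hC
  refine hG.le_errorEvent (hadm k) hC₀ hσ hε0 hε ?_ f hf κ hC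
  rw [Real.norm_of_nonneg (Nat.cast_nonneg _),
    Real.norm_of_nonneg (hadm k).sampleBound_nonneg] at hk
  linarith
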